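/- Let $j=\begin{pmatrix}-1&0\\0&1\end{pmatrix}$. Let $\mu$ be a positive Borel measure without atoms, finite on compact sets, giving positive mass to every nonempty open interval of $[0,\infty)$, and with $\mu([0,\ell))\to\infty$ as $\ell\to\infty$. Let $\mathfrak a\in L^\infty(\mu)$ with $\|\mathfrak a\|_\infty\le 1$ on $[0,\infty)$. Put $$A=\begin{pmatrix}1&-\overline{\mathfrak a}\\-\mathfrak a&1\end{pmatrix},\qquad B=\begin{pmatrix}0&\overline{\mathfrak a}\\-\mathfrak a&0\end{pmatrix},$$ and let $\mathfrak A(z,\ell)$ be the transfer matrix of the canonical system in Arov gauge with parameters $(\mu,\mathfrak a)$, i.e. the solution of $$\mathfrak A(z,\ell)\,j=j+\int_0^\ell \mathfrak A(z,l)\,\bigl(izA(l)-B(l)\bigr)\,d\mu(l),\qquad z\in\mathbb C,\ \ell\ge 0.$$ For $\ell\ge0$ let $\mathfrak A^{[\ell]}(z,l)=\mathfrak A(z,\ell)^{-1}\mathfrak A(z,l+\ell)$ be the coefficient-stripped transfer matrix, and for $z\in\mathbb C_+=\{\operatorname{Im}z>0\}$, $l>0$, let $$D^{[\ell]}(z,l)=\Bigl\{w\in\mathbb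 C:\ \begin{pmatrix}w&1\end{pmatrix}\mathfrak A^{[\ell]}(z,l)\,j\,\mathfrak A^{[\ell]}(z,l)^*\begin{pmatrix}w&1\end{pmatrix}^*\ge0\Bigr\}$$ be its Weyl disks. Then for every $\ell\ge 0$ and $z\in\mathbb C_+$ the intersection $\bigcap_{l>0}D^{[\ell]}(z,l)$ is a single point, denoted $s_+(z,\ell)$ (so $s_+(\cdot,\ell)$ is the Schur function of the system stripped by length $\ell$), and for $\mu$-a.e. $\ell>0$ the function $s_+(\cdot,\ell)$ has the nontangential boundary value $$\lim_{\substack{z\to\infty\\ \arg z\in[\delta,\pi-\delta]}}s_+(z,\ell)=\frac{\mathfrak a(\ell)}{1+\sqrt{1-|\mathfrak a(\ell)|^2}}\qquad\text{for all }\delta>0 .$$ Consequently these boundary values determine $\mathfrak a$: for $\mu$-a.e. $\ell>0$, if $\mathfrak c(\ell)$ denotes the nontangential limit of $s_+(\cdot,\ell)$ at $\infty$, then $$\mathfrak a(\ell)=\frac{2\,\mathfrak c(\ell)}{1+|\mathfrak c(\ell)|^2}.$$ -/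

import Mathlib

open scoped Matrix Topology
open MeasureTheory Filter Set

namespace ArovGauge

/-- The signature matrix `j = diag(-1, 1)`. -/
def j : Matrix (Fin 2) (Fin 2) ℂ := !![-1, 0; 0, 1]

/-- The coefficient `A` of a canonical system in Arov gauge, as a function of the value of the
parameter `𝔞`. -/
def coeffA (a : ℂ) : Matrix (Fin 2) (Fin 2) ℂ := !![1, -star a; -a, 1]

/-- The coefficient `B` of a canonical system in Arov gauge, as a function of the value of the
parameter `𝔞`. -/
def coeffB (a : ℂ) : Matrix (Fin 2) (Fin 2) ℂ := !![0, star a; -a, 0]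

/-- `(μ, 𝔞)` are parameters of a half-line canonical system in Arov gauge: `μ` is a continuous
(atomless) measure finite on compacts, and `𝔞` lies in the closed unit ball of `L^∞(μ)` on
`[0, ∞)`. A measure on the half-line is regarded as a measure on `ℝ`; its restriction to `(-∞, 0)`
plays no role. -/
structure IsParameters (μ : Measure ℝ) (𝔞 : ℝ → ℂ) : Prop where
  locallyFinite : IsLocallyFiniteMeasure μ
  noAtoms : NullSingletonClass μ
  aestronglyMeasurable : AEStronglyMeasurable 𝔞 (μ.restrict (Ici 0))
  norm_le_one : ∀ᵐ l ∂(μ.restrict (Ici 0)), ‖𝔞 l‖ ≤ 1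

/-- The integrand `𝔄(z, l) (i z A(l) - B(l))` of the canonical system. -/
noncomputable def integrand (𝔞 : ℝ → ℂ) (𝔄 : ℂ → ℝ → Matrix (Fin 2) (Fin 2) ℂ) (z : ℂ) (l : ℝ) :
    Matrix (Fin 2) (Fin 2) ℂ :=
  𝔄 z l * ((Complex.I * z) • coeffA (𝔞 l) - coeffB (𝔞 l))

/-- `𝔄` is the transfer matrix, i.e. the solution on `[0, ∞)`, of the canonical system with
parameters `(μ, 𝔞)`:
`𝔄(z, ℓ) j = j + ∫_0^ℓ 𝔄(z, l) (i z A(l) - B(l)) dμ(l)` for all `z ∈ ℂ` and `ℓ ≥ 0`,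
where the integral of a matrix function is taken entry by entry. -/
def IsTransferMatrix (μ : Measure ℝ) (𝔞 : ℝ → ℂ) (𝔄 : ℂ → ℝ → Matrix (Fin 2) (Fin 2) ℂ) : Prop :=
  ∀ (z : ℂ) (ℓ : ℝ), 0 ≤ ℓ → ∀ p q : Fin 2,
    IntervalIntegrable (fun l => integrand 𝔞 𝔄 z l p q) μ 0 ℓ ∧
      (𝔄 z ℓ * j) p q = j p q + ∫ l in (0 : ℝ)..ℓ, integrand 𝔞 𝔄 z l p q ∂μ

/-- The Weyl disk `{w | (w 1) T j T^* (w 1)^* ≥ 0}` of a matrix `T`. The number in question is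
real, since `T j T^*` is Hermitian. -/
def weylDisk (T : Matrix (Fin 2) (Fin 2) ℂ) : Set ℂ :=
  {w | 0 ≤ ((![w, 1] ᵥ* (T * j * Tᴴ)) ⬝ᵥ star ![w, 1]).re}

/-- The intersection `⋂_{l > 0} D(z, l)` of the nested Weyl disks of a family of matrices. -/
def weylLimit (𝔄 : ℂ → ℝ → Matrix (Fin 2) (Fin 2) ℂ) (z : ℂ) : Set ℂ :=
  ⋂ l ∈ Ioi (0 : ℝ), weylDisk (𝔄 z l)

/-- Coefficient stripping by length `ℓ`:
`{𝔄(z, l)}_{l ≥ 0} ↦ {𝔄(z, ℓ)⁻¹ 𝔄(z, l + ℓ)}_{l ≥ 0}`. -/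
noncomputable def strip (𝔄 : ℂ → ℝ → Matrix (Fin 2) (Fin 2) ℂ) (ℓ : ℝ) :
    ℂ → ℝ → Matrix (Fin 2) (Fin 2) ℂ :=
  fun z l => (𝔄 z ℓ)⁻¹ * 𝔄 z (l + ℓ)

/-- The Schur function `s_+(z)` of a family of matrices: the point of `⋂_{l > 0} D(z, l)`
(meaningful when this intersection is a single point, which is the limit point case). -/
noncomputable def schur (𝔄 : ℂ → ℝ → Matrix (Fin 2) (Fin 2) ℂ) (z : ℂ) : ℂ :=
  Classical.epsilon fun w => w ∈ weylLimit 𝔄 z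

/-- The Schur functions `s_+(z, ℓ)` of the coefficient stripped families. -/
noncomputable def schurFlow (𝔄 : ℂ → ℝ → Matrix (Fin 2) (Fin 2) ℂ) (z : ℂ) (ℓ : ℝ) : ℂ :=
  schur (strip 𝔄 ℓ) z

/-- `f(z) → c` as `z → ∞` nontangentially in the upper half-plane: for every `δ > 0`,
`f(z) → c` as `z → ∞` with `arg z ∈ [δ, π - δ]`. -/
def HasNontangentialLimitAtInfty (f : ℂ → ℂ) (c : ℂ) : Prop :=
  ∀ δ : ℝ, 0 < δ →
    Tendsto f (Bornology.cobounded ℂ ⊓ 𝓟 {z : ℂ | z.arg ∈ Icc δ (Real.pi - δ)}) (𝓝 c)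

end ArovGauge

/-!
A row solution `r` of the canonical system satisfies the energy identity
`d(r j r^*) = -2 (Im z) (r A r^*) dμ`, so that `r j r^*` decreases and the Weyl disks are nested.

*Limit point.* A point `w` of all the disks gives a solution starting at `(w, 1)` along which
`r j r^*` stays nonnegative. A suitable combination of `r r^*` and `r j r^*` then decreases at a
rate of at least `r r^*`, which is therefore integrable over the half-line. The determinant of two
solutions is constant and bounded by the sum of their squared norms, so it vanishes since the
half-line has infinite mass.

*Boundary values.* Let `s` be a right Lebesgue point of `𝔞` with respect to `μ`, let `b = 𝔞 s` and
`w = b / (1 + √(1 - |b|²))`. The row `(w, 1)` is an eigenrow of the system with the constant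
coefficient `b`. On an interval `(s, τ]` of mass `κ / |z|` the solution starting at `(s_+(z, s), 1)`
is compared with that system: unless `s_+(z, s)` is close to `w`, the energy density is bounded
below and the dissipated energy exceeds its budget `r j r^* ≤ 1`. This gives
`|s_+(z, s) - w|² ≤ O(1 / κ) + o(1)` as `z → ∞` in a sector, and `κ` is arbitrary.
-/

namespace ArovGauge

/-! ### Integration by parts for an atomless measure -/

theorem integral_Iic_mul_add_mul_integral_Iic {𝕜 : Type*} [RCLike 𝕜] {ν : Measure ℝ} [SFinite ν]
    [NullSingletonClass ν] {f g : ℝ → 𝕜} (hf : Integrable f ν) (hg : Integrable g ν) :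
    (∫ x, (∫ y in Iic x, f y ∂ν) * g x ∂ν) + ∫ x, f x * (∫ y in Iic x, g y ∂ν) ∂ν =
      (∫ x, f x ∂ν) * ∫ x, g x ∂ν := by
  have hfg : Integrable (fun p : ℝ × ℝ => f p.1 * g p.2) (ν.prod ν) := hf.mul_prod hg
  have hT : MeasurableSet {p : ℝ × ℝ | p.1 ≤ p.2} := measurableSet_le measurable_fst measurable_snd
  have hle : ∫ p in {p : ℝ × ℝ | p.1 ≤ p.2}, f p.1 * g p.2 ∂(ν.prod ν) =
      ∫ x, (∫ y in Iic x, f y ∂ν) * g x ∂ν := by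
    rw [← integral_indicator hT, integral_prod_symm _ (hfg.indicator hT)]
    congr with x
    rw [← integral_mul_const, ← integral_indicator measurableSet_Iic]
    rfl
  have hgt : ∫ p in {p : ℝ × ℝ | p.1 ≤ p.2}ᶜ, f p.1 * g p.2 ∂(ν.prod ν) =
      ∫ x, f x * (∫ y in Iic x, g y ∂ν) ∂ν := by
    rw [← integral_indicator hT.compl, integral_prod _ (hfg.indicator hT.compl)]
    congr with x
    rw [integral_Iic_eq_integral_Iio, ← integral_const_mul, ← integral_indicator measurableSet_Iio]
    congr with y
    simp only [indicator, mem_compl_iff, mem_ofPred_eq, not_le, mem_Iio]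
  rw [← hle, ← hgt, integral_add_compl hT hfg, integral_prod_mul]

/-- `f` is a primitive of `f'` with respect to `μ` on the half-line `[s, ∞)`. -/
structure IsPrimitiveFrom {E : Type*} [NormedAddCommGroup E] [NormedSpace ℝ E] (μ : Measure ℝ)
    (s : ℝ) (f f' : ℝ → E) : Prop where
  intervalIntegrable : ∀ t, s ≤ t → IntervalIntegrable f' μ s t
  eq_add_integral : ∀ t, s ≤ t → f t = f s + ∫ x in s..t, f' x ∂μ

namespace IsPrimitiveFrom

variable {E F : Type*} [NormedAddCommGroup E] [NormedSpace ℝ E] [NormedAddCommGroup F]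
  [NormedSpace ℝ F] {μ : Measure ℝ} {s r t : ℝ} {f g f' g' : ℝ → E}

theorem integral (hf : ∀ t, s ≤ t → IntervalIntegrable f' μ s t) :
    IsPrimitiveFrom μ s (fun t => ∫ x in s..t, f' x ∂μ) f' where
  intervalIntegrable := hf
  eq_add_integral t _ := by rw [intervalIntegral.integral_same, zero_add]

theorem intervalIntegrable_of_le (hf : IsPrimitiveFrom μ s f f') (hr : s ≤ r) (ht : r ≤ t) :
    IntervalIntegrable f' μ r t :=
  (hf.intervalIntegrable r hr).symm.trans (hf.intervalIntegrable t (hr.trans ht))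

theorem sub_eq_integral (hf : IsPrimitiveFrom μ s f f') (hr : s ≤ r) (ht : r ≤ t) :
    f t - f r = ∫ x in r..t, f' x ∂μ := by
  rw [hf.eq_add_integral t (hr.trans ht), hf.eq_add_integral r hr, add_sub_add_left_eq_sub,
    intervalIntegral.integral_interval_sub_left (hf.intervalIntegrable t (hr.trans ht))
      (hf.intervalIntegrable r hr)]

theorem mono (hf : IsPrimitiveFrom μ s f f') (hr : s ≤ r) : IsPrimitiveFrom μ r f f' :=
  ⟨fun _ => hf.intervalIntegrable_of_le hr, fun _ ht =>
    eq_add_of_sub_eq' (hf.sub_eq_integral hr ht)⟩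

theorem congr_deriv (hf : IsPrimitiveFrom μ s f f') (h : ∀ t, f' t = g' t) :
    IsPrimitiveFrom μ s f g' :=
  funext h ▸ hf

theorem add (hf : IsPrimitiveFrom μ s f f') (hg : IsPrimitiveFrom μ s g g') :
    IsPrimitiveFrom μ s (fun t => f t + g t) (fun t => f' t + g' t) where
  intervalIntegrable t ht := (hf.intervalIntegrable t ht).add (hg.intervalIntegrable t ht)
  eq_add_integral t ht := by
    rw [intervalIntegral.integral_add (hf.intervalIntegrable t ht) (hg.intervalIntegrable t ht),
      hf.eq_add_integral t ht, hg.eq_add_integral t ht]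
    abel

theorem clm_comp [CompleteSpace E] [CompleteSpace F] (L : E →L[ℝ] F)
    (hf : IsPrimitiveFrom μ s f f') :
    IsPrimitiveFrom μ s (fun t => L (f t)) (fun t => L (f' t)) where
  intervalIntegrable t ht :=
    ⟨L.integrable_comp (hf.intervalIntegrable t ht).1,
      L.integrable_comp (hf.intervalIntegrable t ht).2⟩
  eq_add_integral t ht := by
    rw [L.intervalIntegral_comp_comm (hf.intervalIntegrable t ht), ← map_add,
      ← hf.eq_add_integral t ht]

theorem const_mul {𝕜 : Type*} [RCLike 𝕜] {f f' : ℝ → 𝕜} (c : 𝕜) (hf : IsPrimitiveFrom μ s f f') :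
    IsPrimitiveFrom μ s (fun t => c * f t) (fun t => c * f' t) :=
  hf.clm_comp (ContinuousLinearMap.mul ℝ 𝕜 c)

theorem sub (hf : IsPrimitiveFrom μ s f f') (hg : IsPrimitiveFrom μ s g g') :
    IsPrimitiveFrom μ s (fun t => f t - g t) (fun t => f' t - g' t) where
  intervalIntegrable t ht := (hf.intervalIntegrable t ht).sub (hg.intervalIntegrable t ht)
  eq_add_integral t ht := by
    rw [intervalIntegral.integral_sub (hf.intervalIntegrable t ht) (hg.intervalIntegrable t ht),
      hf.eq_add_integral t ht, hg.eq_add_integral t ht]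
    abel

theorem sub_const (hf : IsPrimitiveFrom μ s f f') (c : E) :
    IsPrimitiveFrom μ s (fun t => f t - c) f' where
  intervalIntegrable := hf.intervalIntegrable
  eq_add_integral t ht := by rw [hf.eq_add_integral t ht, add_sub_right_comm]

theorem continuousOn [NullSingletonClass μ] (hf : IsPrimitiveFrom μ s f f') :
    ContinuousOn f (Icc s t) := by
  rcases le_total s t with ht | ht
  · have h := intervalIntegral.continuousOn_primitive_interval' (hf.intervalIntegrable t ht)
      left_mem_uIcc
    rw [uIcc_of_le ht] at h
    exact (continuousOn_const.add h).congr fun x hx => hf.eq_add_integral x hx.1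
  · exact (subsingleton_Icc_of_ge ht).continuousOn f

theorem le_of_deriv_nonpos {f f' : ℝ → ℝ} (hf : IsPrimitiveFrom μ s f f') (hr : s ≤ r)
    (ht : r ≤ t) (h : ∀ᵐ x ∂(μ.restrict (Ioc r t)), f' x ≤ 0) : f t ≤ f r := by
  rw [← sub_nonpos, hf.sub_eq_integral hr ht, intervalIntegral.integral_of_le ht]
  exact integral_nonpos_of_ae h

theorem measureReal_Ioc [IsLocallyFiniteMeasure μ] (s : ℝ) :
    IsPrimitiveFrom μ s (fun t => μ.real (Ioc s t)) (fun _ => 1) where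
  intervalIntegrable _ _ := intervalIntegrable_const
  eq_add_integral t ht := by simp [intervalIntegral.integral_of_le ht]

section RCLike

variable {𝕜 : Type*} [RCLike 𝕜] [NullSingletonClass μ] {f g f' g' : ℝ → 𝕜}

theorem integral_mul_add_mul [SFinite μ] (hf : IsPrimitiveFrom μ s f f')
    (hg : IsPrimitiveFrom μ s g g') (hf0 : f s = 0) (hg0 : g s = 0) (ht : s ≤ t) :
    (∫ x in s..t, f x * g' x ∂μ) + (∫ x in s..t, f' x * g x ∂μ) = f t * g t := by
  have hIic : ∀ {h h' : ℝ → 𝕜}, IsPrimitiveFrom μ s h h' → h s = 0 → ∀ x ∈ Ioc s t,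
      h x = ∫ y in Iic x, h' y ∂(μ.restrict (Ioc s t)) := by
    intro h h' hh h0 x hx
    rw [hh.eq_add_integral x hx.1.le, h0, zero_add, intervalIntegral.integral_of_le hx.1.le,
      Measure.restrict_restrict measurableSet_Iic, inter_comm, Ioc_inter_Iic, min_eq_right hx.2]
  have key := integral_Iic_mul_add_mul_integral_Iic (hf.intervalIntegrable t ht).1
    (hg.intervalIntegrable t ht).1
  rw [hf.eq_add_integral t ht, hg.eq_add_integral t ht, hf0, hg0, zero_add, zero_add]
  simp only [intervalIntegral.integral_of_le ht]
  rw [← key]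
  congr 1 <;> refine setIntegral_congr_fun measurableSet_Ioc fun x hx => ?_
  · simp only [hIic hf hf0 x hx]
  · simp only [hIic hg hg0 x hx]

theorem mul [SFinite μ] (hf : IsPrimitiveFrom μ s f f') (hg : IsPrimitiveFrom μ s g g') :
    IsPrimitiveFrom μ s (fun t => f t * g t) (fun t => f' t * g t + f t * g' t) := by
  have hf'g : ∀ {f g f' g' : ℝ → 𝕜}, IsPrimitiveFrom μ s f f' → IsPrimitiveFrom μ s g g' →
      ∀ t, s ≤ t → IntervalIntegrable (fun x => f' x * g x) μ s t := fun hf hg t ht =>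
    (hf.intervalIntegrable t ht).mul_continuousOn (by rw [uIcc_of_le ht]; exact hg.continuousOn)
  have hfg' : ∀ t, s ≤ t → IntervalIntegrable (fun x => f x * g' x) μ s t := fun t ht => by
    simpa only [mul_comm] using hf'g hg hf t ht
  refine ⟨fun t ht => (hf'g hf hg t ht).add (hfg' t ht), fun t ht => ?_⟩
  have hcentred := (hf.sub_const (f s)).integral_mul_add_mul (hg.sub_const (g s)) (sub_self _)
    (sub_self _) ht
  simp only [sub_mul, mul_sub] at hcentred
  rw [intervalIntegral.integral_sub (hfg' t ht) ((hg.intervalIntegrable t ht).const_mul _),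
    intervalIntegral.integral_sub (hf'g hf hg t ht) ((hf.intervalIntegrable t ht).mul_const _),
    intervalIntegral.integral_const_mul, intervalIntegral.integral_mul_const,
    ← hf.sub_eq_integral le_rfl ht, ← hg.sub_eq_integral le_rfl ht] at hcentred
  rw [intervalIntegral.integral_add (hf'g hf hg t ht) (hfg' t ht)]
  linear_combination -hcentred

end RCLike

theorem normSq [NullSingletonClass μ] [SFinite μ] {f f' : ℝ → ℂ} (hf : IsPrimitiveFrom μ s f f') :
    IsPrimitiveFrom μ s (fun t => Complex.normSq (f t)) (fun t => 2 * (star (f t) * f' t).re) := by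
  have h := (hf.mul (hf.clm_comp Complex.conjCLE.toContinuousLinearMap)).clm_comp Complex.reCLM
  convert h using 2 with t t
  · simp [Complex.normSq_apply]
  · simp; ring

end IsPrimitiveFrom

/-! ### Forms on row vectors -/

/-- The squared Euclidean norm `r r^*` of a row vector. -/
noncomputable def sqNorm (r : Fin 2 → ℂ) : ℝ := Complex.normSq (r 0) + Complex.normSq (r 1)

/-- The indefinite form `r j r^*` of a row vector. -/
noncomputable def jForm (r : Fin 2 → ℂ) : ℝ := Complex.normSq (r 1) - Complex.normSq (r 0)

/-- The form `r A r^*` of a row vector, for the coefficient matrix `A` with parameter value `a`. -/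
noncomputable def energy (a : ℂ) (r : Fin 2 → ℂ) : ℝ :=
  sqNorm r - 2 * (a * r 1 * star (r 0)).re

/-- The right-hand side `r (i z A - B) j` of the canonical system solved for `dr/dμ`. -/
noncomputable def rowDeriv (a z : ℂ) (r : Fin 2 → ℂ) : Fin 2 → ℂ :=
  r ᵥ* (((Complex.I * z) • coeffA a - coeffB a) * j)

theorem rowDeriv_zero (a z : ℂ) (r : Fin 2 → ℂ) :
    rowDeriv a z r 0 = -(Complex.I * z) * r 0 + (Complex.I * z - 1) * a * r 1 := by
  simp [rowDeriv, Matrix.vecMul_eq_sum, coeffA, coeffB, j]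
  ring

theorem rowDeriv_one (a z : ℂ) (r : Fin 2 → ℂ) :
    rowDeriv a z r 1 = -(Complex.I * z + 1) * star a * r 0 + Complex.I * z * r 1 := by
  simp [rowDeriv, Matrix.vecMul_eq_sum, coeffA, coeffB, j]
  ring

theorem sqNorm_nonneg (r : Fin 2 → ℂ) : 0 ≤ sqNorm r :=
  add_nonneg (Complex.normSq_nonneg _) (Complex.normSq_nonneg _)

theorem sq_norm_add_norm_le (r : Fin 2 → ℂ) : (‖r 0‖ + ‖r 1‖) ^ 2 ≤ 2 * sqNorm r := by
  rw [sqNorm, Complex.normSq_eq_norm_sq, Complex.normSq_eq_norm_sq]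
  exact add_sq_le

theorem two_mul_norm_mul_le (a : ℂ) (r : Fin 2 → ℂ) :
    2 * ‖a * r 1 * star (r 0)‖ ≤ ‖a‖ * sqNorm r := by
  rw [norm_mul, norm_mul, norm_star, sqNorm, Complex.normSq_eq_norm_sq, Complex.normSq_eq_norm_sq]
  linarith [mul_le_mul_of_nonneg_left (two_mul_le_add_sq ‖r 0‖ ‖r 1‖) (norm_nonneg a)]

theorem two_mul_norm_det_le (r r' : Fin 2 → ℂ) :
    2 * ‖r 0 * r' 1 - r 1 * r' 0‖ ≤ sqNorm r + sqNorm r' := by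
  have hdet : ‖r 0 * r' 1 - r 1 * r' 0‖ ≤ ‖r 0‖ * ‖r' 1‖ + ‖r 1‖ * ‖r' 0‖ := by
    simpa only [norm_mul] using norm_sub_le (r 0 * r' 1) (r 1 * r' 0)
  simp only [sqNorm, Complex.normSq_eq_norm_sq]
  linarith [two_mul_le_add_sq ‖r 0‖ ‖r' 1‖, two_mul_le_add_sq ‖r 1‖ ‖r' 0‖]

theorem energy_sub_le (a b : ℂ) (r : Fin 2 → ℂ) :
    energy b r - ‖a - b‖ * sqNorm r ≤ energy a r := by
  have hre := Complex.re_le_norm ((a - b) * r 1 * star (r 0))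
  have hnorm := two_mul_norm_mul_le (a - b) r
  rw [sub_mul, sub_mul, Complex.sub_re, ← sub_mul, ← sub_mul] at hre
  unfold energy
  linarith

theorem energy_nonneg {a : ℂ} (ha : ‖a‖ ≤ 1) (r : Fin 2 → ℂ) : 0 ≤ energy a r := by
  have h := energy_sub_le a 0 r
  simp only [energy, sub_zero, zero_mul, Complex.zero_re, mul_zero] at h ⊢
  linarith [mul_le_of_le_one_left (sqNorm_nonneg r) ha]

theorem sq_im_le_sqNorm_mul_energy {a : ℂ} (ha : ‖a‖ ≤ 1) (r : Fin 2 → ℂ) :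
    2 * (a * r 1 * star (r 0)).im ^ 2 ≤ sqNorm r * energy a r := by
  have hnorm : 4 * ((a * r 1 * star (r 0)).re ^ 2 + (a * r 1 * star (r 0)).im ^ 2) ≤
      sqNorm r ^ 2 := by
    have h := pow_le_pow_left₀ (by positivity) ((two_mul_norm_mul_le a r).trans
      (mul_le_of_le_one_left (sqNorm_nonneg r) ha)) 2
    rw [mul_pow, Complex.sq_norm, Complex.normSq_apply] at h
    linarith
  have hre : 2 * (a * r 1 * star (r 0)).re = sqNorm r - energy a r := by rw [energy]; ring
  have hre_sq : 4 * (a * r 1 * star (r 0)).re ^ 2 = (sqNorm r - energy a r) ^ 2 := by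
    rw [← hre]
    ring
  linarith [sq_nonneg (energy a r)]

theorem cross_terms_le_sqNorm_add_energy {a z : ℂ} (ha : ‖a‖ ≤ 1) {θ : ℝ} (hθ : 0 < θ)
    (r : Fin 2 → ℂ) :
    -(4 * z.re * (a * r 1 * star (r 0)).im) - 4 * (a * r 1 * star (r 0)).re ≤
      (θ - 2) * sqNorm r + 2 * (1 + z.re ^ 2 / θ) * energy a r := by
  have hN := sqNorm_nonneg r
  have hE := energy_nonneg ha r
  have hre : 2 * (a * r 1 * star (r 0)).re = sqNorm r - energy a r := by rw [energy]; ring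
  have him := sq_im_le_sqNorm_mul_energy ha r
  have hamgm : -(4 * z.re * (a * r 1 * star (r 0)).im) ≤
      θ * sqNorm r + 2 * z.re ^ 2 / θ * energy a r := by
    refine (neg_le_abs _).trans (abs_le_of_sq_le_sq ?_ (by positivity))
    have hθ' : θ * sqNorm r * (2 * z.re ^ 2 / θ * energy a r) =
      2 * z.re ^ 2 * (sqNorm r * energy a r) := by field_simp
    nlinarith [mul_le_mul_of_nonneg_left him (sq_nonneg z.re),
      four_mul_le_sq_add (θ * sqNorm r) (2 * z.re ^ 2 / θ * energy a r)]
  have hdiv : 2 * z.re ^ 2 / θ * energy a r = 2 * (z.re ^ 2 / θ) * energy a r := by ring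
  linarith

section ConstantCoefficient

/-! For `b = 2 w / (1 + |w|²)` the system with constant coefficient `b` has the eigenrow `(w, 1)`;
the distance of a row `r` to its span is measured by `r 0 - w * r 1`. -/

variable {b w : ℂ}

theorem one_add_normSq_mul_energy (hb : b * (1 + Complex.normSq w) = 2 * w) (r : Fin 2 → ℂ) :
    (1 + Complex.normSq w) * energy b r =
      Complex.normSq (r 0 - w * r 1) + Complex.normSq (r 1 - star w * r 0) := by
  have hre : (1 + Complex.normSq w) * (b * r 1 * star (r 0)).re =
      (2 * w * r 1 * star (r 0)).re := by
    rw [← hb, ← Complex.re_ofReal_mul]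
    push_cast
    ring_nf
  rw [energy, sqNorm, mul_sub, mul_left_comm, hre]
  simp [Complex.normSq_apply]
  ring

theorem normSq_le_one (hw : ‖w‖ ≤ 1) : Complex.normSq w ≤ 1 := by
  rw [Complex.normSq_eq_norm_sq]
  exact pow_le_one₀ (norm_nonneg w) hw

theorem normSq_sub_mul_le_energy (hw : ‖w‖ ≤ 1)
    (hb : b * (1 + Complex.normSq w) = 2 * w) (r : Fin 2 → ℂ) :
    Complex.normSq (r 0 - w * r 1) ≤ 2 * energy b r := by
  have hid := one_add_normSq_mul_energy hb r
  have h0 := Complex.normSq_nonneg (r 0 - w * r 1)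
  have h1 := Complex.normSq_nonneg (r 1 - star w * r 0)
  have hE : 0 ≤ energy b r := by
    refine nonneg_of_mul_nonneg_right (a := 1 + Complex.normSq w) (by rw [hid]; positivity) ?_
    linarith [Complex.normSq_nonneg w]
  nlinarith [normSq_le_one hw]

theorem rowDeriv_zero_sub_mul_rowDeriv_one (hb : b * (1 + Complex.normSq w) = 2 * w) (a z : ℂ)
    (r : Fin 2 → ℂ) :
    rowDeriv a z r 0 - w * rowDeriv a z r 1 =
      -(Complex.I * z) * ((1 - Complex.normSq w) / (1 + Complex.normSq w) : ℝ) *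
          (r 0 - w * r 1) +
        (Complex.I * z * (a - b) * r 1 + w * (Complex.I * z) * star (a - b) * r 0 - a * r 1 +
          w * star a * r 0) := by
  have hne : (1 + Complex.normSq w : ℂ) ≠ 0 := by
    exact_mod_cast (add_pos_of_pos_of_nonneg one_pos (Complex.normSq_nonneg w)).ne'
  have hb' : b = 2 * w / (1 + Complex.normSq w) := by rw [← hb, mul_div_cancel_right₀ _ hne]
  have hww : w * star w = Complex.normSq w := Complex.mul_conj w
  have hstar : star b = 2 * star w / (1 + Complex.normSq w) := by
    rw [hb']
    simp [Complex.conj_ofReal]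
  rw [rowDeriv_zero, rowDeriv_one, star_sub, hstar, hb']
  push_cast
  field_simp
  linear_combination (2 * Complex.I * z * r 0) * hww

theorem norm_remainder_le (hw : ‖w‖ ≤ 1) {a : ℂ} (ha : ‖a‖ ≤ 1) (z : ℂ) (r : Fin 2 → ℂ) :
    ‖Complex.I * z * (a - b) * r 1 + w * (Complex.I * z) * star (a - b) * r 0 - a * r 1 +
        w * star a * r 0‖ ≤ (‖z‖ * ‖a - b‖ + 1) * (‖r 0‖ + ‖r 1‖) := by
  calc _ ≤ ‖Complex.I * z * (a - b) * r 1‖ + ‖w * (Complex.I * z) * star (a - b) * r 0‖ +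
        ‖a * r 1‖ + ‖w * star a * r 0‖ :=
        norm_add_le_of_le (norm_sub_le_of_le (norm_add_le _ _) le_rfl) le_rfl
    _ = ‖z‖ * ‖a - b‖ * ‖r 1‖ + ‖w‖ * (‖z‖ * ‖a - b‖ * ‖r 0‖) + ‖a‖ * ‖r 1‖ +
        ‖w‖ * (‖a‖ * ‖r 0‖) := by
        simp only [norm_mul, norm_star, Complex.norm_I, one_mul, mul_assoc]
    _ ≤ ‖z‖ * ‖a - b‖ * ‖r 1‖ + ‖z‖ * ‖a - b‖ * ‖r 0‖ + ‖r 1‖ + ‖r 0‖ := by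
        have har := mul_le_of_le_one_left (norm_nonneg (r 0)) ha
        exact add_le_add (add_le_add (add_le_add le_rfl
          (mul_le_of_le_one_left (by positivity) hw))
          (mul_le_of_le_one_left (norm_nonneg _) ha))
          ((mul_le_of_le_one_left (by positivity) hw).trans har)
    _ = _ := by ring

theorem neg_le_deriv_normSq_sub_mul (hw : ‖w‖ ≤ 1) (hb : b * (1 + Complex.normSq w) = 2 * w)
    {a z : ℂ} (ha : ‖a‖ ≤ 1) (hz : 0 ≤ z.im) (r : Fin 2 → ℂ) :
    -(4 * (‖z‖ * ‖a - b‖ + 1) * sqNorm r) ≤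
      2 * (star (r 0 - w * r 1) * (rowDeriv a z r 0 - w * rowDeriv a z r 1)).re := by
  rw [rowDeriv_zero_sub_mul_rowDeriv_one hb]
  set κ : ℝ := (1 - Complex.normSq w) / (1 + Complex.normSq w)
  have hκ : 0 ≤ κ :=
    div_nonneg (sub_nonneg.2 (normSq_le_one hw)) (by linarith [Complex.normSq_nonneg w])
  have hrem := norm_remainder_le (b := b) hw ha z r
  set q := Complex.I * z * (a - b) * r 1 + w * (Complex.I * z) * star (a - b) * r 0 - a * r 1 +
    w * star a * r 0
  have hp : ‖r 0 - w * r 1‖ ≤ ‖r 0‖ + ‖r 1‖ :=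
    norm_sub_le_of_le le_rfl (by
      rw [norm_mul]; exact mul_le_of_le_one_left (norm_nonneg _) hw)
  set p := r 0 - w * r 1
  have hre : (star p * (-(Complex.I * z) * κ * p + q)).re =
      z.im * κ * Complex.normSq p + (star p * q).re := by
    simp [Complex.normSq_apply]
    ring
  have hnonneg : 0 ≤ z.im * κ * Complex.normSq p :=
    mul_nonneg (mul_nonneg hz hκ) (Complex.normSq_nonneg p)
  have hpq : ‖star p * q‖ ≤ (‖z‖ * ‖a - b‖ + 1) * (2 * sqNorm r) :=
    calc ‖star p * q‖ ≤ (‖r 0‖ + ‖r 1‖) * ((‖z‖ * ‖a - b‖ + 1) * (‖r 0‖ + ‖r 1‖)) := by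
          rw [norm_mul, norm_star]
          gcongr
      _ = (‖z‖ * ‖a - b‖ + 1) * (‖r 0‖ + ‖r 1‖) ^ 2 := by ring
      _ ≤ _ := by gcongr; exact sq_norm_add_norm_le r
  have := neg_le_of_abs_le ((Complex.abs_re_le_norm _).trans hpq)
  linarith

end ConstantCoefficient

/-! ### Row solutions and the energy identity -/

/-- `r` is a row solution on `[s, ∞)` of the canonical system with parameters `(μ, a)` at the
spectral parameter `z`. -/
def IsRowSolution (μ : Measure ℝ) (a : ℝ → ℂ) (z : ℂ) (s : ℝ) (r : ℝ → Fin 2 → ℂ) : Prop :=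
  ∀ q, IsPrimitiveFrom μ s (fun t => r t q) (fun t => rowDeriv (a t) z (r t) q)

namespace IsRowSolution

variable {μ : Measure ℝ} {a : ℝ → ℂ} {z : ℂ} {s t τ : ℝ} {r r' : ℝ → Fin 2 → ℂ}

theorem mono (h : IsRowSolution μ a z s r) (ht : s ≤ t) : IsRowSolution μ a z t r :=
  fun q => (h q).mono ht

variable [NullSingletonClass μ] [IsLocallyFiniteMeasure μ]

theorem det_eq (h : IsRowSolution μ a z s r) (h' : IsRowSolution μ a z s r') (ht : s ≤ t) :
    r t 0 * r' t 1 - r t 1 * r' t 0 = r s 0 * r' s 1 - r s 1 * r' s 0 := by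
  have hdet := ((h 0).mul (h' 1)).sub ((h 1).mul (h' 0))
  rw [← sub_eq_zero, hdet.sub_eq_integral le_rfl ht]
  refine intervalIntegral.integral_zero_ae (Eventually.of_forall fun x _ => ?_)
  simp only [rowDeriv_zero, rowDeriv_one]
  ring

theorem isPrimitiveFrom_jForm (h : IsRowSolution μ a z s r) :
    IsPrimitiveFrom μ s (fun t => jForm (r t)) (fun t => -(2 * z.im * energy (a t) (r t))) := by
  refine ((h 1).normSq.sub (h 0).normSq).congr_deriv fun t => ?_
  simp [rowDeriv_zero, rowDeriv_one, energy, sqNorm, Complex.normSq_apply]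
  ring

theorem isPrimitiveFrom_sqNorm (h : IsRowSolution μ a z s r) :
    IsPrimitiveFrom μ s (fun t => sqNorm (r t))
      (fun t => -(2 * z.im * jForm (r t)) - 4 * z.re * (a t * r t 1 * star (r t 0)).im -
        4 * (a t * r t 1 * star (r t 0)).re) := by
  refine ((h 0).normSq.add (h 1).normSq).congr_deriv fun t => ?_
  simp [rowDeriv_zero, rowDeriv_one, jForm, Complex.normSq_apply]
  ring

theorem isPrimitiveFrom_normSq_sub_mul (h : IsRowSolution μ a z s r) (w : ℂ) :
    IsPrimitiveFrom μ s (fun t => Complex.normSq (r t 0 - w * r t 1))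
      (fun t => 2 * (star (r t 0 - w * r t 1) *
        (rowDeriv (a t) z (r t) 0 - w * rowDeriv (a t) z (r t) 1)).re) :=
  ((h 0).sub ((h 1).const_mul w)).normSq

variable (ha : ∀ᵐ t ∂(μ.restrict (Ioi s)), ‖a t‖ ≤ 1)
include ha

theorem jForm_le (h : IsRowSolution μ a z s r) (hz : 0 ≤ z.im) (hτ : s ≤ τ) (ht : τ ≤ t) :
    jForm (r t) ≤ jForm (r τ) := by
  refine h.isPrimitiveFrom_jForm.le_of_deriv_nonpos hτ ht ?_
  filter_upwards [ae_restrict_of_ae_restrict_of_subset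
    (Ioc_subset_Ioi_self.trans (Ioi_subset_Ioi hτ)) ha] with x hx
  exact neg_nonpos.2 (mul_nonneg (by positivity) (energy_nonneg hx _))

/-- The weight `(1 + x² / θ) / y`, for `z = x + i y`, makes the energy terms in the derivatives of
`r r^*` and of `r j r^*` cancel. -/
theorem exists_isPrimitiveFrom_sqNorm_add_jForm (h : IsRowSolution μ a z s r) (hz : 0 < z.im)
    {θ : ℝ} (hθ : 0 < θ) :
    ∃ φ : ℝ → ℝ, IsPrimitiveFrom μ s
        (fun t => sqNorm (r t) + (1 + z.re ^ 2 / θ) / z.im * jForm (r t)) φ ∧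
      ∀ᵐ t ∂(μ.restrict (Ioi s)), φ t ≤ (θ - 2) * sqNorm (r t) - 2 * z.im * jForm (r t) := by
  refine ⟨_, h.isPrimitiveFrom_sqNorm.add (h.isPrimitiveFrom_jForm.const_mul _), ?_⟩
  filter_upwards [ha] with t hat
  have hcancel : (1 + z.re ^ 2 / θ) / z.im * -(2 * z.im * energy (a t) (r t)) =
      -(2 * (1 + z.re ^ 2 / θ) * energy (a t) (r t)) := by field_simp
  linarith [cross_terms_le_sqNorm_add_energy (z := z) hat hθ (r t)]

/-- Two solutions with `r j r^* ≥ 0` are linearly dependent: otherwise the constant determinant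
bounds `r r^* + r' r'^*` from below, which contradicts the infinite mass of `μ`. -/
theorem det_eq_zero (h : IsRowSolution μ a z s r) (h' : IsRowSolution μ a z s r')
    (hz : 0 < z.im) (hμ : Tendsto (fun t => μ.real (Ioc s t)) atTop atTop)
    (hr : ∀ t, s ≤ t → 0 ≤ jForm (r t)) (hr' : ∀ t, s ≤ t → 0 ≤ jForm (r' t)) :
    r s 0 * r' s 1 - r s 1 * r' s 0 = 0 := by
  obtain ⟨φ, hφ, hφ_le⟩ := h.exists_isPrimitiveFrom_sqNorm_add_jForm ha hz one_pos
  obtain ⟨φ', hφ', hφ'_le⟩ := h'.exists_isPrimitiveFrom_sqNorm_add_jForm ha hz one_pos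
  set C := (1 + z.re ^ 2 / 1) / z.im
  have hC0 : 0 ≤ C := by positivity
  set D := 2 * ‖r s 0 * r' s 1 - r s 1 * r' s 0‖
  set K := sqNorm (r s) + C * jForm (r s) + (sqNorm (r' s) + C * jForm (r' s))
  have hbound : ∀ t, s ≤ t → D * μ.real (Ioc s t) ≤ K := by
    intro t ht
    have hdecr := ((hφ.add hφ').add ((IsPrimitiveFrom.measureReal_Ioc s).const_mul
      D)).le_of_deriv_nonpos le_rfl ht (by
        filter_upwards [ae_restrict_of_ae_restrict_of_subset Ioc_subset_Ioi_self hφ_le,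
          ae_restrict_of_ae_restrict_of_subset Ioc_subset_Ioi_self hφ'_le,
          ae_restrict_mem measurableSet_Ioc] with x hx hx' hxs
        have hdet := two_mul_norm_det_le (r x) (r' x)
        rw [h.det_eq h' hxs.1.le] at hdet
        linarith [mul_nonneg hz.le (hr x hxs.1.le), mul_nonneg hz.le (hr' x hxs.1.le)])
    simp only [Ioc_self, measureReal_empty, mul_zero, add_zero] at hdecr
    linarith [mul_nonneg hC0 (hr t ht), mul_nonneg hC0 (hr' t ht), sqNorm_nonneg (r t),
      sqNorm_nonneg (r' t)]
  by_contra hne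
  have hDpos : 0 < D := by positivity
  obtain ⟨t, hKt, hst⟩ := ((hμ.const_mul_atTop hDpos).eventually_gt_atTop K |>.and
    (eventually_ge_atTop s)).exists
  exact (hbound t hst).not_gt hKt

/-- A bound that does not degenerate as `z → ∞` when `μ (s, τ]` is comparable to `1 / |z|`. -/
theorem sqNorm_le (h : IsRowSolution μ a z s r) (hz : 0 < z.im)
    (hτ : 0 < μ.real (Ioc s τ)) (hr : 0 ≤ jForm (r τ)) (ht : t ∈ Icc s τ) :
    sqNorm (r t) ≤
      2 * (sqNorm (r s) + (1 + 2 * z.re ^ 2 * μ.real (Ioc s τ)) / z.im * jForm (r s)) := by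
  have hsτ : s ≤ τ := ht.1.trans ht.2
  set m := μ.real (Ioc s τ)
  obtain ⟨φ, hφ, hφ_le⟩ := h.exists_isPrimitiveFrom_sqNorm_add_jForm ha hz
    (θ := 1 / (2 * m)) (by positivity)
  rw [show z.re ^ 2 / (1 / (2 * m)) = 2 * z.re ^ 2 * m by field_simp] at hφ
  set C := (1 + 2 * z.re ^ 2 * m) / z.im
  have hC0 : 0 ≤ C := by positivity
  have hr0 : ∀ x ∈ Icc s τ, 0 ≤ jForm (r x) := fun x hx => hr.trans (h.jForm_le ha hz.le hx.1 hx.2)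
  obtain ⟨x₀, hx₀, hmax⟩ := isCompact_Icc.exists_isMaxOn (nonempty_Icc.2 hsτ)
    h.isPrimitiveFrom_sqNorm.continuousOn
  set M := sqNorm (r x₀)
  have hgrowth := (hφ.sub ((IsPrimitiveFrom.measureReal_Ioc s).const_mul
    (1 / (2 * m) * M))).le_of_deriv_nonpos le_rfl hx₀.1 (by
      filter_upwards [ae_restrict_of_ae_restrict_of_subset Ioc_subset_Ioi_self hφ_le,
        ae_restrict_mem measurableSet_Ioc] with x hx hxs
      have hxτ : x ∈ Icc s τ := ⟨hxs.1.le, hxs.2.trans hx₀.2⟩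
      have hxM : 1 / (2 * m) * sqNorm (r x) ≤ 1 / (2 * m) * M :=
        mul_le_mul_of_nonneg_left (hmax hxτ) (by positivity)
      linarith [mul_nonneg hz.le (hr0 x hxτ), sqNorm_nonneg (r x)])
  have hmass : 1 / (2 * m) * M * μ.real (Ioc s x₀) ≤ M / 2 :=
    calc _ ≤ 1 / (2 * m) * M * m := by
          refine mul_le_mul_of_nonneg_left ?_ (mul_nonneg (by positivity) (sqNorm_nonneg _))
          exact measureReal_mono (Ioc_subset_Ioc_right hx₀.2) measure_Ioc_lt_top.ne
      _ = M / 2 := by field_simp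
  simp only [Ioc_self, measureReal_empty, mul_zero, sub_zero] at hgrowth
  have hMt : sqNorm (r t) ≤ M := hmax ht
  linarith [mul_nonneg hC0 (hr0 x₀ hx₀)]

end IsRowSolution

/-! ### Comparison with a constant coefficient -/

namespace IsRowSolution

section Comparison

variable {μ : Measure ℝ} {a : ℝ → ℂ} {z : ℂ} {s t τ : ℝ} {r : ℝ → Fin 2 → ℂ}
variable [NullSingletonClass μ] [IsLocallyFiniteMeasure μ]
variable (ha : ∀ᵐ t ∂(μ.restrict (Ioi s)), ‖a t‖ ≤ 1)
variable {b w : ℂ} {g : ℝ → ℝ} {M : ℝ}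
include ha

theorem normSq_sub_mul_sub_le (h : IsRowSolution μ a z s r) (hz : 0 ≤ z.im) (hw : ‖w‖ ≤ 1)
    (hb : b * (1 + Complex.normSq w) = 2 * w) (hg : IsPrimitiveFrom μ s g fun t => ‖a t - b‖)
    (hg0 : g s = 0) (hM : ∀ t ∈ Icc s τ, sqNorm (r t) ≤ M) (ht : t ∈ Icc s τ) :
    Complex.normSq (r s 0 - w * r s 1) - 4 * M * (‖z‖ * g τ + μ.real (Ioc s τ)) ≤
      Complex.normSq (r t 0 - w * r t 1) := by
  have hgrowth := ((h.isPrimitiveFrom_normSq_sub_mul w).const_mul (-1) |>.sub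
    (((hg.const_mul ‖z‖).add (IsPrimitiveFrom.measureReal_Ioc s)).const_mul
      (4 * M))).le_of_deriv_nonpos le_rfl ht.1 (by
    filter_upwards [ae_restrict_of_ae_restrict_of_subset Ioc_subset_Ioi_self ha,
      ae_restrict_mem measurableSet_Ioc] with x hx hxs
    have hderiv := neg_le_deriv_normSq_sub_mul hw hb hx hz (r x)
    have hMx := mul_le_mul_of_nonneg_left (hM x ⟨hxs.1.le, hxs.2.trans ht.2⟩)
      (by positivity : 0 ≤ ‖z‖ * ‖a x - b‖ + 1)
    linarith)
  have hgt : g t ≤ g τ := by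
    rw [← sub_nonneg, hg.sub_eq_integral ht.1 ht.2]
    exact intervalIntegral.integral_nonneg ht.2 fun _ _ => norm_nonneg _
  have hmono : 4 * M * (‖z‖ * g t + μ.real (Ioc s t)) ≤
      4 * M * (‖z‖ * g τ + μ.real (Ioc s τ)) := by
    have hM0 : 0 ≤ M := (sqNorm_nonneg _).trans (hM t ht)
    gcongr
    · exact measure_Ioc_lt_top.ne
    · exact ht.2
  simp only [hg0, Ioc_self, measureReal_empty, mul_zero, add_zero, sub_zero] at hgrowth
  linarith

/-- The energy dissipated on `(s, τ]` is at most `r j r^*` at `s`, while its density controls the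
distance to the eigenrow `(w, 1)`. -/
theorem im_mul_normSq_sub_mul_le (h : IsRowSolution μ a z s r) (hz : 0 ≤ z.im) (hw : ‖w‖ ≤ 1)
    (hb : b * (1 + Complex.normSq w) = 2 * w) (hg : IsPrimitiveFrom μ s g fun t => ‖a t - b‖)
    (hg0 : g s = 0) (hτ : s ≤ τ) (hr : 0 ≤ jForm (r τ)) (hM : ∀ t ∈ Icc s τ, sqNorm (r t) ≤ M) :
    z.im * μ.real (Ioc s τ) * (Complex.normSq (r s 0 - w * r s 1) -
        4 * M * (‖z‖ * g τ + μ.real (Ioc s τ))) ≤ jForm (r s) + 2 * z.im * M * g τ := by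
  set K := Complex.normSq (r s 0 - w * r s 1) - 4 * M * (‖z‖ * g τ + μ.real (Ioc s τ))
  have hdissip := (h.isPrimitiveFrom_jForm.add (((IsPrimitiveFrom.measureReal_Ioc s).const_mul
    (z.im * K)).sub (hg.const_mul (2 * z.im * M)))).le_of_deriv_nonpos le_rfl hτ (by
      filter_upwards [ae_restrict_mem measurableSet_Ioc] with x hxs
      have hx : x ∈ Icc s τ := Ioc_subset_Icc_self hxs
      have henergy : K ≤ 2 * (energy (a x) (r x) + ‖a x - b‖ * M) :=
        calc K ≤ Complex.normSq (r x 0 - w * r x 1) :=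
              h.normSq_sub_mul_sub_le ha hz hw hb hg hg0 hM hx
          _ ≤ 2 * energy b (r x) := normSq_sub_mul_le_energy hw hb (r x)
          _ ≤ 2 * (energy (a x) (r x) + ‖a x - b‖ * sqNorm (r x)) := by
              linarith [energy_sub_le (a x) b (r x)]
          _ ≤ _ := by gcongr; exact hM x hx
      linarith [mul_le_mul_of_nonneg_left henergy hz])
  simp only [hg0, Ioc_self, measureReal_empty, mul_zero, add_zero, sub_zero] at hdissip
  linarith

theorem sqNorm_le_of_sector (h : IsRowSolution μ a z s r) (h1 : r s 1 = 1) {c κ : ℝ} (hc : 0 < c)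
    (hκ : 0 < κ) (hcz : c * ‖z‖ ≤ z.im) (hz : 1 ≤ z.im) (hm : ‖z‖ * μ.real (Ioc s τ) = κ)
    (hr : 0 ≤ jForm (r τ)) (ht : t ∈ Icc s τ) : sqNorm (r t) ≤ 6 + 4 * κ / c := by
  have hz0 : 0 < z.im := one_pos.trans_le hz
  have hsum : sqNorm (r s) + jForm (r s) = 2 := by
    rw [sqNorm, jForm, h1, map_one]
    ring
  have hJ0 : 0 ≤ jForm (r s) := hr.trans (h.jForm_le ha hz0.le le_rfl (ht.1.trans ht.2))
  have hJ1 : jForm (r s) ≤ 1 := by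
    rw [jForm, h1, map_one]
    linarith [Complex.normSq_nonneg (r s 0)]
  have hmpos : 0 < μ.real (Ioc s τ) := pos_of_mul_pos_right (hm ▸ hκ) (norm_nonneg z)
  have hweight : (1 + 2 * z.re ^ 2 * μ.real (Ioc s τ)) / z.im ≤ 1 + 2 * κ / c := by
    rw [add_div, mul_div_assoc]
    refine add_le_add (div_le_one_of_le₀ hz hz0.le) ?_
    have hre : z.re ^ 2 ≤ ‖z‖ ^ 2 := by
      rw [← sq_abs]
      exact pow_le_pow_left₀ (abs_nonneg _) (Complex.abs_re_le_norm z) 2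
    calc 2 * z.re ^ 2 * (μ.real (Ioc s τ) / z.im)
        ≤ 2 * ‖z‖ ^ 2 * (μ.real (Ioc s τ) / z.im) := by gcongr
      _ = 2 * κ * (‖z‖ / z.im) := by rw [← hm]; ring
      _ ≤ 2 * κ * (1 / c) := by
          refine mul_le_mul_of_nonneg_left ?_ (by positivity)
          rwa [div_le_div_iff₀ hz0 hc, one_mul, mul_comm]
      _ = 2 * κ / c := by ring
  refine (h.sqNorm_le ha hz0 hmpos hr ht).trans ?_
  have hprod := mul_le_mul hweight hJ1 hJ0 (by positivity)
  have hκc : 4 * κ / c = 2 * (2 * κ / c) := by ring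
  linarith

theorem normSq_sub_le_of_sector (h : IsRowSolution μ a z s r) (h1 : r s 1 = 1) (hw : ‖w‖ ≤ 1)
    (hb : b * (1 + Complex.normSq w) = 2 * w) (hg : IsPrimitiveFrom μ s g fun t => ‖a t - b‖)
    (hg0 : g s = 0) {c κ : ℝ} (hc : 0 < c) (hκ : 0 < κ) (hcz : c * ‖z‖ ≤ z.im) (hz : 1 ≤ z.im)
    (hτ : s ≤ τ) (hm : ‖z‖ * μ.real (Ioc s τ) = κ) (hr : 0 ≤ jForm (r τ)) :
    Complex.normSq (r s 0 - w) ≤ 1 / (c * κ) + (6 + 4 * κ / c) *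
      ((2 + 4 * κ) * (g τ / μ.real (Ioc s τ)) + 4 * (κ / ‖z‖)) := by
  have hz0 : 0 < z.im := one_pos.trans_le hz
  have hmpos : 0 < μ.real (Ioc s τ) := pos_of_mul_pos_right (hm ▸ hκ) (norm_nonneg z)
  have hestimate := h.im_mul_normSq_sub_mul_le ha hz0.le hw hb hg hg0 hτ hr
    fun t ht => h.sqNorm_le_of_sector ha h1 hc hκ hcz hz hm hr ht
  set m := μ.real (Ioc s τ)
  set M := 6 + 4 * κ / c
  have hJ : jForm (r s) ≤ 1 := by
    rw [jForm, h1, map_one]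
    linarith [Complex.normSq_nonneg (r s 0)]
  rw [h1, mul_one] at hestimate
  have hcκ : c * κ ≤ z.im * m := by
    rw [← hm, ← mul_assoc]
    gcongr
  have hzpos : 0 < ‖z‖ := hz0.trans_le ((le_abs_self _).trans (Complex.abs_im_le_norm z))
  calc Complex.normSq (r s 0 - w)
      ≤ (1 + 2 * z.im * M * g τ) / (z.im * m) + 4 * M * (‖z‖ * g τ + m) := by
        rw [← sub_le_iff_le_add, le_div_iff₀' (by positivity)]
        linarith
    _ = 1 / (z.im * m) + M * ((2 + 4 * κ) * (g τ / m) + 4 * (κ / ‖z‖)) := by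
        rw [← hm]
        field_simp
        ring
    _ ≤ _ := by gcongr

end Comparison
end IsRowSolution

/-! ### Weyl disks -/

section WeylDisk

variable {T : Matrix (Fin 2) (Fin 2) ℂ} {w : ℂ}

theorem mem_weylDisk_iff : w ∈ weylDisk T ↔ 0 ≤ jForm (![w, 1] ᵥ* T) := by
  have hform : ((![w, 1] ᵥ* (T * j * Tᴴ)) ⬝ᵥ star ![w, 1]).re = jForm (![w, 1] ᵥ* T) := by
    simp [jForm, j, Matrix.vecMul, dotProduct, Matrix.mul_apply, Fin.sum_univ_two,
      Complex.normSq_apply, Matrix.conjTranspose_apply]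
    ring
  rw [weylDisk, mem_ofPred_eq, hform]

theorem isClosed_weylDisk (T : Matrix (Fin 2) (Fin 2) ℂ) : IsClosed (weylDisk T) := by
  have hpreimage : weylDisk T = {w | 0 ≤ jForm (![w, 1] ᵥ* T)} := ext fun _ => mem_weylDisk_iff
  rw [hpreimage]
  have hcont : Continuous fun w : ℂ => ![w, 1] ᵥ* T := by fun_prop
  exact isClosed_le continuous_const
    ((Complex.continuous_normSq.comp ((continuous_apply 1).comp hcont)).sub
      (Complex.continuous_normSq.comp ((continuous_apply 0).comp hcont)))

theorem weylDisk_one : weylDisk 1 = Metric.closedBall 0 1 := by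
  ext w
  rw [mem_weylDisk_iff]
  simp [jForm, Complex.normSq_eq_norm_sq]

theorem weylDisk_nonempty_of_jForm_neg (hT : jForm (T 0) < 0) : (weylDisk T).Nonempty := by
  have hne : T 0 0 ≠ 0 := by
    intro h0
    rw [jForm, h0, map_zero, sub_zero] at hT
    exact hT.not_ge (Complex.normSq_nonneg _)
  refine ⟨-T 1 0 / T 0 0, mem_weylDisk_iff.2 ?_⟩
  simp [jForm, Matrix.vecMul_eq_sum, hne, Complex.normSq_nonneg]

end WeylDisk

/-- `T` is the solution on `[s, ∞)`, normalised by `T s = 1`, of the canonical system with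
parameters `(μ, a)` at the spectral parameter `z`. -/
structure IsFundamentalSolution (μ : Measure ℝ) (a : ℝ → ℂ) (z : ℂ) (s : ℝ)
    (T : ℝ → Matrix (Fin 2) (Fin 2) ℂ) : Prop where
  initial : T s = 1
  row : ∀ p, IsRowSolution μ a z s fun t => T t p

section FundamentalSolution

variable {μ : Measure ℝ} {a : ℝ → ℂ} {z : ℂ} {s t τ : ℝ} {T : ℝ → Matrix (Fin 2) (Fin 2) ℂ}

theorem IsRowSolution.vecMul (hT : ∀ p, IsRowSolution μ a z s fun t => T t p) (c : Fin 2 → ℂ) :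
    IsRowSolution μ a z s fun t => c ᵥ* T t := by
  intro q
  have hentry : (fun t => (c ᵥ* T t) q) = fun t => c 0 * T t 0 q + c 1 * T t 1 q := by
    ext t
    simp [Matrix.vecMul_eq_sum]
  change IsPrimitiveFrom μ s (fun t => (c ᵥ* T t) q) _
  rw [hentry]
  refine (((hT 0 q).const_mul (c 0)).add ((hT 1 q).const_mul (c 1))).congr_deriv fun t => ?_
  fin_cases q <;> simp [rowDeriv_zero, rowDeriv_one, Matrix.vecMul_eq_sum] <;> ring

namespace IsFundamentalSolution

theorem vecMul (hT : IsFundamentalSolution μ a z s T) (c : Fin 2 → ℂ) :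
    IsRowSolution μ a z s fun t => c ᵥ* T t :=
  .vecMul hT.row c

variable [NullSingletonClass μ] [IsLocallyFiniteMeasure μ]

theorem det_eq_one (hT : IsFundamentalSolution μ a z s T) (ht : s ≤ t) : (T t).det = 1 := by
  rw [Matrix.det_fin_two, (hT.row 0).det_eq (hT.row 1) ht, hT.initial]
  simp

theorem restart (hT : IsFundamentalSolution μ a z s T) (hτ : s ≤ τ) :
    IsFundamentalSolution μ a z τ fun t => (T τ)⁻¹ * T t where
  initial := Matrix.nonsing_inv_mul _ (by rw [hT.det_eq_one hτ]; exact isUnit_one)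
  row p := by
    simpa only [Matrix.mul_apply_eq_vecMul] using (hT.vecMul ((T τ)⁻¹ p)).mono hτ

variable (ha : ∀ᵐ t ∂(μ.restrict (Ioi s)), ‖a t‖ ≤ 1)
include ha

theorem weylDisk_anti (hT : IsFundamentalSolution μ a z s T) (hz : 0 ≤ z.im) (hτ : s ≤ τ)
    (ht : τ ≤ t) : weylDisk (T t) ⊆ weylDisk (T τ) := fun _ hw =>
  mem_weylDisk_iff.2 ((mem_weylDisk_iff.1 hw).trans ((hT.vecMul _).jForm_le ha hz hτ ht))

theorem weylDisk_nonempty (hT : IsFundamentalSolution μ a z s T) (hz : 0 ≤ z.im) (ht : s ≤ t) :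
    (weylDisk (T t)).Nonempty := by
  refine weylDisk_nonempty_of_jForm_neg (((hT.row 0).jForm_le ha hz le_rfl ht).trans_lt ?_)
  simp [hT.initial, jForm]

theorem jForm_nonneg_of_mem_iInter (hT : IsFundamentalSolution μ a z s T) (hz : 0 ≤ z.im) {w : ℂ}
    (hw : w ∈ ⋂ t ∈ Ioi s, weylDisk (T t)) (ht : s ≤ t) : 0 ≤ jForm (![w, 1] ᵥ* T t) :=
  mem_weylDisk_iff.1 (hT.weylDisk_anti ha hz ht (lt_add_one t).le
    (mem_iInter₂.1 hw (t + 1) (ht.trans_lt (lt_add_one t))))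

theorem nonempty_iInter_weylDisk (hT : IsFundamentalSolution μ a z s T) (hz : 0 ≤ z.im) :
    (⋂ t ∈ Ioi s, weylDisk (T t)).Nonempty := by
  have hle : ∀ n : ℕ, s ≤ s + n := fun n => le_add_of_nonneg_right n.cast_nonneg
  obtain ⟨w, hw⟩ := IsCompact.nonempty_iInter_of_sequence_nonempty_isCompact_isClosed
    (fun n : ℕ => weylDisk (T (s + n)))
    (fun n => hT.weylDisk_anti ha hz (hle n) (by gcongr; exact n.le_succ))
    (fun n => hT.weylDisk_nonempty ha hz (hle n))
    (by rw [Nat.cast_zero, add_zero, hT.initial, weylDisk_one]; exact isCompact_closedBall 0 1)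
    fun n => isClosed_weylDisk _
  refine ⟨w, mem_iInter₂.2 fun t ht => ?_⟩
  obtain ⟨n, hn⟩ := exists_nat_ge (t - s)
  exact hT.weylDisk_anti ha hz (mem_Ioi.1 ht).le (sub_le_iff_le_add'.1 hn) (mem_iInter.1 hw n)

theorem exists_iInter_weylDisk_eq_singleton (hT : IsFundamentalSolution μ a z s T)
    (hz : 0 < z.im) (hμ : Tendsto (fun t => μ.real (Ioc s t)) atTop atTop) :
    ∃ w, ⋂ t ∈ Ioi s, weylDisk (T t) = {w} := by
  obtain ⟨w, hw⟩ := hT.nonempty_iInter_weylDisk ha hz.le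
  refine ⟨w, eq_singleton_iff_unique_mem.2 ⟨hw, fun w' hw' => ?_⟩⟩
  have hdet := (hT.vecMul ![w', 1]).det_eq_zero ha (hT.vecMul ![w, 1]) hz hμ
    (fun t ht => hT.jForm_nonneg_of_mem_iInter ha hz.le hw' ht)
    (fun t ht => hT.jForm_nonneg_of_mem_iInter ha hz.le hw ht)
  simpa [hT.initial, sub_eq_zero] using hdet

end IsFundamentalSolution

theorem weylLimit_strip (𝔄 : ℂ → ℝ → Matrix (Fin 2) (Fin 2) ℂ) (z : ℂ) (ℓ : ℝ) :
    weylLimit (strip 𝔄 ℓ) z = ⋂ t ∈ Ioi ℓ, weylDisk ((𝔄 z ℓ)⁻¹ * 𝔄 z t) := by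
  ext w
  simp only [weylLimit, strip, mem_iInter, mem_Ioi]
  refine ⟨fun h t ht => ?_, fun h l hl => h (l + ℓ) (lt_add_of_pos_left ℓ hl)⟩
  simpa only [sub_add_cancel] using h (t - ℓ) (sub_pos.2 ht)

theorem weylLimit_eq_singleton_schur {𝔄 : ℂ → ℝ → Matrix (Fin 2) (Fin 2) ℂ}
    (h : ∃ w, weylLimit 𝔄 z = {w}) : weylLimit 𝔄 z = {schur 𝔄 z} := by
  obtain ⟨w, hw⟩ := h
  have hmem : schur 𝔄 z ∈ weylLimit 𝔄 z :=
    Classical.epsilon_spec (p := fun w => w ∈ weylLimit 𝔄 z) ⟨w, hw ▸ mem_singleton w⟩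
  rw [hw, mem_singleton_iff] at hmem
  rw [hw, hmem]

theorem IsTransferMatrix.isFundamentalSolution {𝔄 : ℂ → ℝ → Matrix (Fin 2) (Fin 2) ℂ}
    (h𝔄 : IsTransferMatrix μ a 𝔄) (z : ℂ) : IsFundamentalSolution μ a z 0 (𝔄 z) := by
  have hjj : j * j = 1 := by
    ext p q
    fin_cases p <;> fin_cases q <;> simp [j]
  have hinitial : 𝔄 z 0 = 1 := by
    have hj : 𝔄 z 0 * j = j := by
      ext p q
      rw [(h𝔄 z 0 le_rfl p q).2, intervalIntegral.integral_same, add_zero]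
    rw [← mul_one (𝔄 z 0), ← hjj, ← mul_assoc, hj]
  have hprim : ∀ p q, IsPrimitiveFrom μ 0 (fun t => (𝔄 z t * j) p q)
      fun t => integrand a 𝔄 z t p q := fun p q =>
    ⟨fun t ht => (h𝔄 z t ht p q).1, fun t ht => by
      rw [(h𝔄 z t ht p q).2, hinitial, one_mul]⟩
  refine ⟨hinitial, fun p q => ?_⟩
  have hentry : (fun t => 𝔄 z t p q) = fun t => j q q * (𝔄 z t * j) p q := by
    ext t
    fin_cases q <;> simp [j, Matrix.mul_apply]
  change IsPrimitiveFrom μ 0 (fun t => 𝔄 z t p q) _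
  rw [hentry]
  refine ((hprim p q).const_mul (j q q)).congr_deriv fun t => ?_
  fin_cases q <;>
    simp [rowDeriv_zero, rowDeriv_one, integrand, coeffA, coeffB, j, Matrix.mul_apply] <;>
    ring

end FundamentalSolution

/-! ### Right Lebesgue points of an atomless measure -/

section RightLebesguePoint

variable {E : Type*} [NormedAddCommGroup E]

section Quantile

/-- The quantile function of `μ` on `[s, ∞)`: the first point `t ≥ s` with `μ (s, t] ≥ u`. It
transports Lebesgue measure on `(0, ∞)` to `μ` on `(s, ∞)` even if `μ` does not charge every
interval. -/
noncomputable def quantile (μ : Measure ℝ) (s u : ℝ) : ℝ :=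
  sInf {t | s ≤ t ∧ u ≤ μ.real (Ioc s t)}

variable {μ : Measure ℝ} [IsLocallyFiniteMeasure μ] {s t u v x : ℝ}

theorem measureReal_Ioc_add_measureReal_Ioc (hx : s ≤ x) (ht : x ≤ t) :
    μ.real (Ioc s x) + μ.real (Ioc x t) = μ.real (Ioc s t) := by
  rw [← Ioc_union_Ioc_eq_Ioc hx ht, measureReal_union (Ioc_disjoint_Ioc_of_le le_rfl)
    measurableSet_Ioc measure_Ioc_lt_top.ne measure_Ioc_lt_top.ne]

theorem monotone_measureReal_Ioc (s : ℝ) : Monotone fun t => μ.real (Ioc s t) := fun _ _ h =>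
  measureReal_mono (Ioc_subset_Ioc_right h) measure_Ioc_lt_top.ne

theorem continuous_measureReal_Ioc [NullSingletonClass μ] (s : ℝ) :
    Continuous fun t => μ.real (Ioc s t) := by
  have hintegral : (fun t => μ.real (Ioc s t)) = fun t => ∫ _ in s..max s t, (1 : ℝ) ∂μ := by
    ext t
    rcases le_total s t with h | h
    · simp [max_eq_right h, intervalIntegral.integral_of_le h]
    · simp [max_eq_left h, Ioc_eq_empty h.not_gt]
  rw [hintegral]
  exact (intervalIntegral.continuous_primitive (fun _ _ => intervalIntegrable_const) s).comp
    (continuous_const.max continuous_id)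

variable [NullSingletonClass μ] (hμ : Tendsto (fun t => μ.real (Ioc s t)) atTop atTop)
include hμ

theorem quantile_mem (u : ℝ) : quantile μ s u ∈ {t | s ≤ t ∧ u ≤ μ.real (Ioc s t)} := by
  refine IsClosed.csInf_mem ?_ ?_ ⟨s, fun t ht => ht.1⟩
  · exact isClosed_Ici.inter (isClosed_le continuous_const (continuous_measureReal_Ioc s))
  · exact ((eventually_ge_atTop s).and (hμ.eventually_ge_atTop u)).exists

theorem quantile_le_iff (ht : s ≤ t) : quantile μ s u ≤ t ↔ u ≤ μ.real (Ioc s t) :=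
  ⟨fun h => (quantile_mem hμ u).2.trans (monotone_measureReal_Ioc s h),
    fun h => csInf_le ⟨s, fun _ ht => ht.1⟩ ⟨ht, h⟩⟩

theorem lt_quantile_iff (ht : s ≤ t) : t < quantile μ s u ↔ μ.real (Ioc s t) < u :=
  lt_iff_lt_of_le_iff_le (quantile_le_iff hμ ht)

theorem monotone_quantile : Monotone (quantile μ s) := fun _ v huv =>
  (quantile_le_iff hμ (quantile_mem hμ v).1).2 (huv.trans (quantile_mem hμ v).2)

theorem measureReal_Ioc_quantile (hu : 0 ≤ u) : μ.real (Ioc s (quantile μ s u)) = u := by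
  obtain ⟨hs, hle⟩ := quantile_mem hμ u
  obtain ⟨t, ht, rfl⟩ := intermediate_value_Icc hs (continuous_measureReal_Ioc s).continuousOn
    ⟨by simpa using hu, hle⟩
  exact le_antisymm (monotone_measureReal_Ioc s ((quantile_le_iff hμ ht.1).2 le_rfl)) hle

theorem quantile_preimage_Ioc (hx : s ≤ x) (ht : x ≤ t) :
    quantile μ s ⁻¹' Ioc x t = Ioc (μ.real (Ioc s x)) (μ.real (Ioc s t)) := by
  ext u
  rw [mem_preimage, mem_Ioc, mem_Ioc, lt_quantile_iff hμ hx, quantile_le_iff hμ (hx.trans ht)]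

theorem quantile_preimage_Ioi : quantile μ s ⁻¹' Ioi s = Ioi 0 := by
  ext u
  rw [mem_preimage, mem_Ioi, lt_quantile_iff hμ le_rfl, Ioc_self, measureReal_empty, mem_Ioi]

theorem measurePreserving_quantile :
    MeasurePreserving (quantile μ s) (volume.restrict (Ioi 0)) (μ.restrict (Ioi s)) := by
  refine ⟨(monotone_quantile hμ).measurable, Eq.symm (Measure.ext_of_Ioc _ _ fun x t _ => ?_)⟩
  rw [Measure.map_apply (monotone_quantile hμ).measurable measurableSet_Ioc,
    Measure.restrict_apply ((monotone_quantile hμ).measurable measurableSet_Ioc),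
    Measure.restrict_apply measurableSet_Ioc, ← quantile_preimage_Ioi hμ, ← preimage_inter,
    Ioc_inter_Ioi]
  rcases le_total (max x s) t with h | h
  · rw [quantile_preimage_Ioc hμ (le_max_right x s) h, Real.volume_Ioc,
      ← measureReal_Ioc_add_measureReal_Ioc (le_max_right x s) h, add_sub_cancel_left,
      ofReal_measureReal measure_Ioc_lt_top.ne]
  · rw [Ioc_eq_empty h.not_gt, preimage_empty, measure_empty, measure_empty]

theorem measurePreserving_quantile_Ioc (hx : s ≤ x) (ht : x ≤ t) :
    MeasurePreserving (quantile μ s)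
      (volume.restrict (Ioc (μ.real (Ioc s x)) (μ.real (Ioc s t)))) (μ.restrict (Ioc x t)) := by
  have h := (measurePreserving_quantile hμ).restrict_preimage (measurableSet_Ioc (a := x) (b := t))
  rwa [quantile_preimage_Ioc hμ hx ht, Measure.restrict_restrict measurableSet_Ioc,
    Measure.restrict_restrict measurableSet_Ioc,
    inter_eq_left.2 (Ioc_subset_Ioi_self.trans (Ioi_subset_Ioi measureReal_nonneg)),
    inter_eq_left.2 (Ioc_subset_Ioi_self.trans (Ioi_subset_Ioi hx))] at h

theorem measurePreserving_measureReal_Ioc :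
    MeasurePreserving (fun t => μ.real (Ioc s t)) (μ.restrict (Ioi s))
      (volume.restrict (Ioi 0)) := by
  have hmeas : Measurable fun t => μ.real (Ioc s t) := (monotone_measureReal_Ioc s).measurable
  have hquantile := measurePreserving_quantile hμ
  refine ⟨hmeas, ?_⟩
  rw [← hquantile.map_eq, Measure.map_map hmeas hquantile.measurable]
  refine (Measure.map_congr ?_).trans Measure.map_id
  filter_upwards [ae_restrict_mem measurableSet_Ioi] with u hu
  exact measureReal_Ioc_quantile hμ (mem_Ioi.1 hu).le

theorem ae_quantile_measureReal_Ioc :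
    ∀ᵐ t ∂(μ.restrict (Ioi s)), quantile μ s (μ.real (Ioc s t)) = t := by
  have hquantile := measurePreserving_quantile hμ
  have hmeas : MeasurableSet {t | quantile μ s (μ.real (Ioc s t)) = t} := measurableSet_eq_fun
    (hquantile.measurable.comp (monotone_measureReal_Ioc s).measurable) measurable_id
  rw [← hquantile.map_eq, ae_map_iff hquantile.aemeasurable hmeas]
  filter_upwards [ae_restrict_mem measurableSet_Ioi] with u hu
  rw [measureReal_Ioc_quantile hμ (mem_Ioi.1 hu).le]

theorem intervalIntegrable_comp_quantile {f : ℝ → E} (hu : 0 ≤ u)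
    (hf : IntervalIntegrable f μ s (quantile μ s u)) :
    IntervalIntegrable (fun v => f (quantile μ s v)) volume 0 u := by
  have hs := (quantile_mem hμ u).1
  have hq := measurePreserving_quantile_Ioc hμ le_rfl hs
  rw [Ioc_self, measureReal_empty, measureReal_Ioc_quantile hμ hu] at hq
  rw [intervalIntegrable_iff_integrableOn_Ioc_of_le hs] at hf
  rw [intervalIntegrable_iff_integrableOn_Ioc_of_le hu]
  exact hq.integrable_comp_of_integrable hf

theorem integral_comp_quantile [NormedSpace ℝ E] {f : ℝ → E} (hx : s ≤ x) (ht : x ≤ t)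
    (hf : AEStronglyMeasurable f (μ.restrict (Ioc x t))) :
    ∫ u in μ.real (Ioc s x)..μ.real (Ioc s t), f (quantile μ s u) = ∫ y in x..t, f y ∂μ := by
  have hq := measurePreserving_quantile_Ioc hμ hx ht
  rw [intervalIntegral.integral_of_le (monotone_measureReal_Ioc s ht),
    intervalIntegral.integral_of_le ht, ← hq.map_eq,
    integral_map hq.aemeasurable (by rwa [hq.map_eq])]

end Quantile

theorem ae_tendsto_rightAverage_volume {f : ℝ → E}
    (hf : ∀ t, 0 ≤ t → IntervalIntegrable f volume 0 t) :
    ∀ᵐ x ∂(volume.restrict (Ioi (0 : ℝ))),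
      Tendsto (fun t => (∫ y in x..t, ‖f y - f x‖) / (t - x)) (𝓝[>] x) (𝓝 0) := by
  have hloc : LocallyIntegrable ((Ioi 0).indicator f) := locallyIntegrable_iff.2 fun K hK => by
    obtain ⟨R, hR⟩ := hK.bddAbove
    rw [IntegrableOn, integrable_indicator_iff measurableSet_Ioi, IntegrableOn,
      Measure.restrict_restrict measurableSet_Ioi]
    refine ((intervalIntegrable_iff_integrableOn_Ioc_of_le (le_max_right R 0)).1
      (hf _ (le_max_right R 0))).mono_set fun x hx => ⟨hx.1, (hR hx.2).trans (le_max_left R 0)⟩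
  filter_upwards [ae_restrict_of_ae ((IsUnifLocDoublingMeasure.vitaliFamily
    (volume : Measure ℝ) 1).ae_tendsto_average_norm_sub hloc),
    ae_restrict_mem measurableSet_Ioi] with x hx hx0
  refine (hx.comp (Real.tendsto_Icc_vitaliFamily_right x)).congr' ?_
  filter_upwards [self_mem_nhdsWithin] with t ht
  have hxt : x ≤ t := (mem_Ioi.1 ht).le
  rw [Function.comp_apply, setAverage_eq, integral_Icc_eq_integral_Ioc,
    ← intervalIntegral.integral_of_le hxt, measureReal_def, Real.volume_Icc,
    ENNReal.toReal_ofReal (sub_nonneg.2 hxt), smul_eq_mul, inv_mul_eq_div]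
  congr 1
  refine intervalIntegral.integral_congr fun y hy => ?_
  rw [uIcc_of_le hxt] at hy
  simp only [indicator_of_mem hx0, indicator_of_mem (mem_Ioi.2 ((mem_Ioi.1 hx0).trans_le hy.1))]

/-- For a general `μ` the right neighbourhoods of `x` are measured by `μ`: `t` may stay away from
`x` as long as `μ (x, t]` tends to `0`. -/
theorem ae_tendsto_rightAverage {μ : Measure ℝ} [IsLocallyFiniteMeasure μ] [NullSingletonClass μ]
    {s : ℝ} (hμ : Tendsto (fun t => μ.real (Ioc s t)) atTop atTop) {f : ℝ → E}
    (hf : ∀ t, s ≤ t → IntervalIntegrable f μ s t) :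
    ∀ᵐ x ∂(μ.restrict (Ioi s)),
      Tendsto (fun t => (∫ y in x..t, ‖f y - f x‖ ∂μ) / μ.real (Ioc x t))
        (comap (fun t => μ.real (Ioc x t)) (𝓝[>] 0)) (𝓝 0) := by
  filter_upwards [(measurePreserving_measureReal_Ioc hμ).quasiMeasurePreserving.ae
    (ae_tendsto_rightAverage_volume
      fun u hu => intervalIntegrable_comp_quantile hμ hu (hf _ (quantile_mem hμ u).1)),
    ae_quantile_measureReal_Ioc hμ,
    ae_restrict_mem measurableSet_Ioi] with x hx hqx hsx
  have hsx : s ≤ x := (mem_Ioi.1 hsx).le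
  have hshift : Tendsto (fun t => μ.real (Ioc s x) + μ.real (Ioc x t))
      (comap (fun t => μ.real (Ioc x t)) (𝓝[>] 0)) (𝓝[>] (μ.real (Ioc s x))) := by
    have h := tendsto_comap (f := fun t => μ.real (Ioc x t)) (x := 𝓝[>] (0 : ℝ))
    refine tendsto_nhdsWithin_iff.2 ⟨?_, ?_⟩
    · simpa using (tendsto_nhds_of_tendsto_nhdsWithin h).const_add (μ.real (Ioc s x))
    · filter_upwards [h.eventually self_mem_nhdsWithin] with t ht
      exact lt_add_of_pos_right _ ht
  refine (hx.comp hshift).congr' ?_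
  filter_upwards [tendsto_comap.eventually self_mem_nhdsWithin] with t ht
  have hxt : x ≤ t := le_of_lt <| by
    by_contra! h
    simp [Ioc_eq_empty h.not_gt] at ht
  have hnorm : AEStronglyMeasurable (fun y => ‖f y - f x‖) (μ.restrict (Ioc x t)) :=
    (((hf t (hsx.trans hxt)).1.mono_set (Ioc_subset_Ioc_left hsx)).aestronglyMeasurable.sub
      aestronglyMeasurable_const).norm
  simp only [Function.comp_apply, hqx]
  rw [measureReal_Ioc_add_measureReal_Ioc hsx hxt, integral_comp_quantile hμ hsx hxt hnorm,
    ← measureReal_Ioc_add_measureReal_Ioc hsx hxt, add_sub_cancel_left]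

end RightLebesguePoint

/-! ### Nontangential limits -/

theorem sin_mul_norm_le_im {δ : ℝ} {z : ℂ} (hδ : 0 < δ) (hz : z.arg ∈ Icc δ (Real.pi - δ)) :
    Real.sin δ * ‖z‖ ≤ z.im := by
  have hsin : Real.sin δ ≤ Real.sin z.arg := by
    rcases le_total z.arg (Real.pi / 2) with h | h
    · exact Real.sin_le_sin_of_le_of_le_pi_div_two (by linarith [Real.pi_pos]) h hz.1
    · rw [← Real.sin_pi_sub z.arg]
      exact Real.sin_le_sin_of_le_of_le_pi_div_two (by linarith [Real.pi_pos]) (by linarith)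
        (by linarith [hz.2])
  rw [← Complex.norm_mul_sin_arg z, mul_comm]
  exact mul_le_mul_of_nonneg_left hsin (norm_nonneg z)

theorem hasNontangentialLimitAtInfty_of_tendsto {f : ℂ → ℂ} {w : ℂ}
    (h : ∀ c : ℝ, 0 < c → Tendsto f (Bornology.cobounded ℂ ⊓ 𝓟 {z | c * ‖z‖ ≤ z.im}) (𝓝 w)) :
    HasNontangentialLimitAtInfty f w := by
  intro δ hδ
  rcases lt_or_ge δ Real.pi with hδπ | hδπ
  · exact (h _ (Real.sin_pos_of_pos_of_lt_pi hδ hδπ)).mono_left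
      (inf_le_inf_left _ (principal_mono.2 fun z hz => sin_mul_norm_le_im hδ hz))
  · have hempty : {z : ℂ | z.arg ∈ Icc δ (Real.pi - δ)} = ∅ := by
      rw [Icc_eq_empty (by linarith)]
      rfl
    rw [hempty, principal_empty, inf_bot_eq]
    exact tendsto_bot

theorem HasNontangentialLimitAtInfty.unique {f : ℂ → ℂ} {c d : ℂ}
    (hc : HasNontangentialLimitAtInfty f c) (hd : HasNontangentialLimitAtInfty f d) : c = d := by
  have himaginary : Tendsto (fun r : ℝ => (r : ℂ) * Complex.I) atTop (Bornology.cobounded ℂ ⊓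
      𝓟 {z : ℂ | z.arg ∈ Icc (Real.pi / 2) (Real.pi - Real.pi / 2)}) := by
    refine tendsto_inf.2 ⟨?_, tendsto_principal.2 ?_⟩
    · rw [← tendsto_norm_atTop_iff_cobounded]
      simpa using tendsto_abs_atTop_atTop
    · filter_upwards [eventually_gt_atTop 0] with r hr
      rw [Complex.arg_real_mul _ hr, Complex.arg_I]
      constructor <;> linarith
  have hδ : 0 < Real.pi / 2 := by positivity
  exact tendsto_nhds_unique ((hc _ hδ).comp himaginary) ((hd _ hδ).comp himaginary)

section InfiniteMass

variable {μ : Measure ℝ} [IsLocallyFiniteMeasure μ] {s x : ℝ}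

theorem tendsto_measureReal_Ioc_atTop [NullSingletonClass μ]
    (h : Tendsto (fun t => μ (Ico s t)) atTop (𝓝 ⊤)) :
    Tendsto (fun t => μ.real (Ioc s t)) atTop atTop := by
  refine tendsto_atTop.2 fun C => ?_
  filter_upwards [h.eventually (lt_mem_nhds (ENNReal.ofReal_lt_top (r := C)))] with t ht
  rw [measureReal_def, ← ENNReal.ofReal_le_iff_le_toReal measure_Ioc_lt_top.ne,
    ← measure_congr (Ico_ae_eq_Ioc (μ := μ))]
  exact ht.le

theorem tendsto_measureReal_Ioc_of_le (hμ : Tendsto (fun t => μ.real (Ioc s t)) atTop atTop)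
    (hx : s ≤ x) : Tendsto (fun t => μ.real (Ioc x t)) atTop atTop := by
  refine (tendsto_atTop_add_const_left atTop (-μ.real (Ioc s x)) hμ).congr' ?_
  filter_upwards [eventually_ge_atTop x] with t ht
  rw [← measureReal_Ioc_add_measureReal_Ioc hx ht, neg_add_cancel_left]

theorem tendsto_quantile_div_norm [NullSingletonClass μ]
    (hμ : Tendsto (fun t => μ.real (Ioc s t)) atTop atTop) {κ : ℝ} (hκ : 0 < κ) :
    Tendsto (fun z : ℂ => quantile μ s (κ / ‖z‖)) (Bornology.cobounded ℂ)
      (comap (fun t => μ.real (Ioc s t)) (𝓝[>] 0)) := by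
  have hmass : ∀ z : ℂ, μ.real (Ioc s (quantile μ s (κ / ‖z‖))) = κ / ‖z‖ := fun z =>
    measureReal_Ioc_quantile hμ (by positivity)
  refine tendsto_comap_iff.2 (tendsto_nhdsWithin_iff.2 ⟨?_, ?_⟩)
  · simpa only [Function.comp_def, hmass] using
      tendsto_norm_cobounded_atTop.const_div_atTop κ
  · filter_upwards [tendsto_norm_cobounded_atTop.eventually_gt_atTop 0] with z hz
    rw [Function.comp_apply, hmass]
    exact div_pos hκ hz

end InfiniteMass

theorem tendsto_of_forall_eventually_normSq_sub_le {ι : Type*} {l : Filter ι} {f : ι → ℂ} {w : ℂ}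
    {c : ℝ} {e : ℝ → ι → ℝ} (hc : 0 < c) (he : ∀ κ, 0 < κ → Tendsto (e κ) l (𝓝 0))
    (h : ∀ κ, 0 < κ → ∀ᶠ x in l, Complex.normSq (f x - w) ≤ 1 / (c * κ) + e κ x) :
    Tendsto f l (𝓝 w) := by
  rw [Metric.tendsto_nhds]
  intro ε hε
  have hκ : 0 < 2 / (c * ε ^ 2) := by positivity
  have hhalf : 1 / (c * (2 / (c * ε ^ 2))) = ε ^ 2 / 2 := by field_simp
  filter_upwards [h _ hκ, (he _ hκ).eventually (gt_mem_nhds (half_pos (pow_pos hε 2)))]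
    with x hx hex
  rw [hhalf, Complex.normSq_eq_norm_sq] at hx
  rw [dist_eq_norm]
  exact lt_of_pow_lt_pow_left₀ 2 hε.le (by linarith)

section LebesguePoint

variable {μ : Measure ℝ} [NullSingletonClass μ] [IsLocallyFiniteMeasure μ] {a : ℝ → ℂ} {s : ℝ}

theorem IsFundamentalSolution.hasNontangentialLimitAtInfty {T : ℂ → ℝ → Matrix (Fin 2) (Fin 2) ℂ}
    {b w : ℂ} {f : ℂ → ℂ} (ha : ∀ᵐ t ∂(μ.restrict (Ioi s)), ‖a t‖ ≤ 1)
    (hT : ∀ z, IsFundamentalSolution μ a z s (T z))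
    (hμ : Tendsto (fun t => μ.real (Ioc s t)) atTop atTop)
    (hf : ∀ z, 0 < z.im → f z ∈ ⋂ t ∈ Ioi s, weylDisk (T z t))
    (hw : ‖w‖ ≤ 1) (hb : b * (1 + Complex.normSq w) = 2 * w)
    (hint : ∀ t, s ≤ t → IntervalIntegrable a μ s t)
    (hlim : Tendsto (fun t => (∫ x in s..t, ‖a x - b‖ ∂μ) / μ.real (Ioc s t))
      (comap (fun t => μ.real (Ioc s t)) (𝓝[>] 0)) (𝓝 0)) :
    HasNontangentialLimitAtInfty f w := by
  have hg : IsPrimitiveFrom μ s (fun t => ∫ x in s..t, ‖a x - b‖ ∂μ) fun t => ‖a t - b‖ :=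
    .integral fun t ht => ((hint t ht).sub intervalIntegrable_const).norm
  refine hasNontangentialLimitAtInfty_of_tendsto fun c hc =>
    tendsto_of_forall_eventually_normSq_sub_le (e := fun κ z => (6 + 4 * κ / c) * ((2 + 4 * κ) *
      ((∫ x in s..quantile μ s (κ / ‖z‖), ‖a x - b‖ ∂μ) /
        μ.real (Ioc s (quantile μ s (κ / ‖z‖)))) + 4 * (κ / ‖z‖))) hc (fun κ hκ => ?_)
      fun κ hκ => eventually_inf_principal.2 ?_
  · have haverage := (hlim.comp (tendsto_quantile_div_norm hμ hκ)).const_mul (2 + 4 * κ)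
    have hmass := (tendsto_norm_cobounded_atTop (E := ℂ)).const_div_atTop κ
    simpa using ((haverage.add (hmass.const_mul 4)).const_mul (6 + 4 * κ / c)).mono_left inf_le_left
  · filter_upwards [tendsto_norm_cobounded_atTop.eventually_ge_atTop c⁻¹] with z hcz hsector
    have hnorm : 0 < ‖z‖ := (inv_pos.2 hc).trans_le hcz
    have him : 1 ≤ z.im := ((inv_le_iff_one_le_mul₀' hc).1 hcz).trans hsector
    have hτ := (quantile_mem hμ (κ / ‖z‖)).1
    have hrow := ((hT z).vecMul ![f z, 1]).normSq_sub_le_of_sector ha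
      (by simp [(hT z).initial]) hw hb hg intervalIntegral.integral_same hc hκ hsector him hτ
      (by rw [measureReal_Ioc_quantile hμ (by positivity), mul_div_cancel₀ _ hnorm.ne'])
      ((hT z).jForm_nonneg_of_mem_iInter ha (zero_le_one.trans him)
        (hf z (one_pos.trans_le him)) hτ)
    simpa [(hT z).initial] using hrow

end LebesguePoint

theorem norm_div_one_add_sqrt_le_one {b : ℂ} (hb : ‖b‖ ≤ 1) :
    ‖b / (1 + (Real.sqrt (1 - ‖b‖ ^ 2) : ℂ))‖ ≤ 1 := by
  have hsqrt := Real.sqrt_nonneg (1 - ‖b‖ ^ 2)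
  rw [norm_div, ← Complex.ofReal_one, ← Complex.ofReal_add, Complex.norm_of_nonneg (by linarith)]
  exact div_le_one_of_le₀ (by linarith) (by linarith)

theorem mul_one_add_normSq_div_one_add_sqrt {b : ℂ} (hb : ‖b‖ ≤ 1) :
    b * (1 + Complex.normSq (b / (1 + (Real.sqrt (1 - ‖b‖ ^ 2) : ℂ)))) =
      2 * (b / (1 + (Real.sqrt (1 - ‖b‖ ^ 2) : ℂ))) := by
  have hsq := Real.sq_sqrt (sub_nonneg.2 (pow_le_one₀ (n := 2) (norm_nonneg b) hb))
  have hsqrt := Real.sqrt_nonneg (1 - ‖b‖ ^ 2)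
  set r := Real.sqrt (1 - ‖b‖ ^ 2)
  have hr : 0 < 1 + r := by linarith
  have hnormSq : Complex.normSq (b / (1 + (r : ℂ))) = (1 - r) / (1 + r) := by
    rw [← Complex.ofReal_one, ← Complex.ofReal_add, map_div₀, Complex.normSq_ofReal,
      Complex.normSq_eq_norm_sq]
    field_simp
    linarith
  have hr' : (1 + (r : ℂ)) ≠ 0 := mod_cast hr.ne'
  rw [hnormSq]
  push_cast
  field_simp
  ring

theorem eq_two_mul_div_one_add_norm_sq {b c : ℂ} (h : b * (1 + Complex.normSq c) = 2 * c) :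
    b = 2 * c / (1 + (‖c‖ : ℂ) ^ 2) := by
  have hne : (1 + (‖c‖ : ℂ) ^ 2) ≠ 0 := mod_cast (by positivity : (0 : ℝ) < 1 + ‖c‖ ^ 2).ne'
  rw [eq_div_iff hne, ← h, Complex.normSq_eq_norm_sq, Complex.ofReal_pow]

namespace IsTransferMatrix

variable {μ : Measure ℝ} [NullSingletonClass μ] [IsLocallyFiniteMeasure μ] {a : ℝ → ℂ}
  {𝔄 : ℂ → ℝ → Matrix (Fin 2) (Fin 2) ℂ} {ℓ : ℝ}
  (h𝔄 : IsTransferMatrix μ a 𝔄) (ha : ∀ᵐ t ∂(μ.restrict (Ici 0)), ‖a t‖ ≤ 1)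
  (hμ : Tendsto (fun t => μ.real (Ioc 0 t)) atTop atTop) (hℓ : 0 ≤ ℓ)
include h𝔄 ha hμ hℓ

theorem weylLimit_strip_eq_singleton {z : ℂ} (hz : 0 < z.im) :
    weylLimit (strip 𝔄 ℓ) z = {schurFlow 𝔄 z ℓ} := by
  refine weylLimit_eq_singleton_schur ?_
  rw [weylLimit_strip]
  exact ((h𝔄.isFundamentalSolution z).restart hℓ).exists_iInter_weylDisk_eq_singleton
    (ae_restrict_of_ae_restrict_of_subset (Ioi_subset_Ici hℓ) ha) hz
    (tendsto_measureReal_Ioc_of_le hμ hℓ)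

theorem hasNontangentialLimitAtInfty_schurFlow
    (hint : ∀ t, 0 ≤ t → IntervalIntegrable a μ 0 t) (haℓ : ‖a ℓ‖ ≤ 1)
    (hlim : Tendsto (fun t => (∫ x in ℓ..t, ‖a x - a ℓ‖ ∂μ) / μ.real (Ioc ℓ t))
      (comap (fun t => μ.real (Ioc ℓ t)) (𝓝[>] 0)) (𝓝 0)) :
    HasNontangentialLimitAtInfty (fun z => schurFlow 𝔄 z ℓ)
      (a ℓ / (1 + (Real.sqrt (1 - ‖a ℓ‖ ^ 2) : ℂ))) :=
  IsFundamentalSolution.hasNontangentialLimitAtInfty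
    (ae_restrict_of_ae_restrict_of_subset (Ioi_subset_Ici hℓ) ha)
    (fun z => (h𝔄.isFundamentalSolution z).restart hℓ) (tendsto_measureReal_Ioc_of_le hμ hℓ)
    (fun z hz => by
      rw [← weylLimit_strip, h𝔄.weylLimit_strip_eq_singleton ha hμ hℓ hz]
      exact mem_singleton _)
    (norm_div_one_add_sqrt_le_one haℓ) (mul_one_add_normSq_div_one_add_sqrt haℓ)
    (fun t ht => (hint ℓ hℓ).symm.trans (hint t (hℓ.trans ht))) hlim

end IsTransferMatrix

theorem IsParameters.intervalIntegrable {μ : Measure ℝ} {a : ℝ → ℂ} (h : IsParameters μ a) {t : ℝ}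
    (ht : 0 ≤ t) : IntervalIntegrable a μ 0 t := by
  have := h.locallyFinite
  have hsub : Ioc 0 t ⊆ Ici 0 := fun x hx => hx.1.le
  rw [intervalIntegrable_iff_integrableOn_Ioc_of_le ht]
  exact .of_bound measure_Ioc_lt_top (h.aestronglyMeasurable.mono_set hsub) 1
    (ae_restrict_of_ae_restrict_of_subset hsub h.norm_le_one)

end ArovGauge

theorem proposition1p5_general (μ : Measure ℝ) (𝔞 : ℝ → ℂ)
    (𝔄 : ℂ → ℝ → Matrix (Fin 2) (Fin 2) ℂ) (hpar : ArovGauge.IsParameters μ 𝔞)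
    (hlp : Tendsto (fun ℓ : ℝ => μ (Ico 0 ℓ)) atTop (𝓝 ⊤))
    (hsol : ArovGauge.IsTransferMatrix μ 𝔞 𝔄) :
    (∀ ℓ : ℝ, 0 ≤ ℓ → ∀ z : ℂ, 0 < z.im →
      ArovGauge.weylLimit (ArovGauge.strip 𝔄 ℓ) z = {ArovGauge.schurFlow 𝔄 z ℓ}) ∧
    ∀ᵐ ℓ ∂(μ.restrict (Ioi 0)),
      ArovGauge.HasNontangentialLimitAtInfty (fun z => ArovGauge.schurFlow 𝔄 z ℓ)
        (𝔞 ℓ / (1 + (Real.sqrt (1 - ‖𝔞 ℓ‖ ^ 2) : ℂ))) ∧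
      ∀ c : ℂ, ArovGauge.HasNontangentialLimitAtInfty (fun z => ArovGauge.schurFlow 𝔄 z ℓ) c →
        𝔞 ℓ = 2 * c / (1 + (‖c‖ : ℂ) ^ 2) := by
  open ArovGauge in
  have := hpar.locallyFinite
  have := hpar.noAtoms
  have hμ := tendsto_measureReal_Ioc_atTop hlp
  have hbound := hpar.norm_le_one
  have hint : ∀ t, 0 ≤ t → IntervalIntegrable 𝔞 μ 0 t := fun t => hpar.intervalIntegrable
  refine ⟨fun ℓ hℓ z hz => hsol.weylLimit_strip_eq_singleton hbound hμ hℓ hz, ?_⟩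
  filter_upwards [ae_tendsto_rightAverage hμ hint, ae_restrict_mem measurableSet_Ioi,
    ae_restrict_of_ae_restrict_of_subset Ioi_subset_Ici_self hbound] with ℓ hlebesgue hℓ haℓ
  have hlimit := hsol.hasNontangentialLimitAtInfty_schurFlow hbound hμ (mem_Ioi.1 hℓ).le hint haℓ
    hlebesgue
  refine ⟨hlimit, fun c hc => eq_two_mul_div_one_add_norm_sq ?_⟩
  rw [hc.unique hlimit]
  exact mul_one_add_normSq_div_one_add_sqrt haℓ

theorem proposition1p5 (μ : Measure ℝ) (𝔞 : ℝ → ℂ) (𝔄 : ℂ → ℝ → Matrix (Fin 2) (Fin 2) ℂ)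
    (hpar : ArovGauge.IsParameters μ 𝔞)
    (hlp : Tendsto (fun ℓ : ℝ => μ (Ico 0 ℓ)) atTop (𝓝 ⊤))
    (hpos : ∀ ℓ₁ ℓ₂ : ℝ, 0 ≤ ℓ₁ → ℓ₁ < ℓ₂ → 0 < μ (Ioo ℓ₁ ℓ₂))
    (hsol : ArovGauge.IsTransferMatrix μ 𝔞 𝔄) :
    (∀ ℓ : ℝ, 0 ≤ ℓ → ∀ z : ℂ, 0 < z.im →
      ArovGauge.weylLimit (ArovGauge.strip 𝔄 ℓ) z = {ArovGauge.schurFlow 𝔄 z ℓ}) ∧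
    ∀ᵐ ℓ ∂(μ.restrict (Ioi 0)),
      ArovGauge.HasNontangentialLimitAtInfty (fun z => ArovGauge.schurFlow 𝔄 z ℓ)
        (𝔞 ℓ / (1 + (Real.sqrt (1 - ‖𝔞 ℓ‖ ^ 2) : ℂ))) ∧
      ∀ c : ℂ, ArovGauge.HasNontangentialLimitAtInfty (fun z => ArovGauge.schurFlow 𝔄 z ℓ) c →
        𝔞 ℓ = 2 * c / (1 + (‖c‖ : ℂ) ^ 2) :=
  proposition1p5_general μ 𝔞 𝔄 hpar hlp hsol
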